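/- Let $\varepsilon>0$, $C_0>0$ and $\alpha>4$ be real numbers. There is a constant $C$, depending only on $\varepsilon$, $C_0$ and $\alpha$, such that the following holds for every integer $n\ge 1$. Let $H=(H_{ij})_{1\le i,j\le n}$ be an $n\times n$ random Hermitian matrix (with complex entries, on an arbitrary probability space) such that the random variables $(H_{ij})_{1\le i\le j\le n}$ are independent and, for all $i,j$, $$\mathbb{E}H_{ij}=0,\qquad n\,\mathbb{E}|H_{ij}|^2\le 1,\qquad \mathbb{P}\left(\sqrt n\,|H_{ij}|\ge t\right)\le C_0\,t^{-\alpha}\quad\text{for every } t>0.$$ Then $$\mathbb{P}\left(\|H\|\ge 2+\varepsilon\right)\le C\,n^{-\frac{\alpha-4}{4}},$$ where $\|H\|$ denotes the operator norm of $H$ associated with the Euclidean norm on $\mathbb{C}^n$. -/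

import Mathlib

open MeasureTheory ProbabilityTheory

/-! ### Walks, half-traversed edges and weights -/

section Walks

variable {V : Type*} [DecidableEq V]

/-! The proof is truncation followed by the moment method with about log n moments. Entries are cut
at K = n^(-η) with η = β/α and β = (α-4)/4. By the tail bound some entry exceeds K with probability
at most C₀ n^(-β). The cut shifts the means by a matrix of norm at most ε/2 for large n, so it
remains to treat centred entries bounded by 2K (`measureReal_le_norm_le_add`).

For such a matrix X, ‖X‖^t ≤ tr X^t when t = 2·2^j (`norm_pow_le_trace`), and E tr X^t is a sum over
closed walks. Independence and centring bound each term by a product of step weights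
(`norm_integral_walkProd_le`): a = 1/n for discovering a vertex, 1 for first retracing a discovery
edge, and the entry bound for any other step.

The sum over walks is controlled one step at a time, with no enumeration of graphs. Discoveries
contribute at most 1 in total. From any vertex at most one return is "default", contributing at most
1 more. The other returns are paid for by a potential: the weight is multiplied by L^`excess`,
discoveries and default returns never raise `excess`, an ambiguous return lowers it, and a remaining
step raises it by at most one (`walkPotential_cons_le`). With M bounding the number of visited
vertices, each step costs at most 2 + M(1/L + KL), where K is now the entry bound. For M = O(log n)
and L proportional to M this is close to 2 (`exists_power_of_two_moment`), and Markov's inequality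
concludes. -/

/-- Walks are lists with the current vertex first. `halfEdges l` is the set of oriented edges
`(u, v)` such that `v` was discovered from `u` and the edge has been traversed once so far. -/
def halfEdges : List V → Finset (V × V)
  | y :: x :: l =>
      if y ∉ x :: l then insert (x, y) (halfEdges (x :: l))
      else ((halfEdges (x :: l)).erase (x, y)).erase (y, x)
  | _ => ∅

/-- The weight of a walk: `a` for a step to a new vertex, `1` for the second traversal of the edge
of such a step, `K` for any other step. -/
def walkWeight (a K : ℝ) : List V → ℝ
  | y :: x :: l =>
      (if y ∉ x :: l then a
        else if (x, y) ∈ halfEdges (x :: l) ∨ (y, x) ∈ halfEdges (x :: l) then 1 else K)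
        * walkWeight a K (x :: l)
  | _ => 1

/-- Number of traversals of an edge. -/
def edgeCount : List V → Sym2 V → ℕ
  | y :: x :: l, e => edgeCount (x :: l) e + if e = s(x, y) then 1 else 0
  | _, _ => 0

lemma halfEdges_new {x y : V} {l : List V} (h : y ∉ x :: l) :
    halfEdges (y :: x :: l) = insert (x, y) (halfEdges (x :: l)) := by
  rw [halfEdges, if_pos h]

lemma halfEdges_old {x y : V} {l : List V} (h : y ∈ x :: l) :
    halfEdges (y :: x :: l) = ((halfEdges (x :: l)).erase (x, y)).erase (y, x) := by
  rw [halfEdges, if_neg (not_not.2 h)]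

lemma mem_of_mem_halfEdges {u v : V} :
    ∀ {l : List V}, (u, v) ∈ halfEdges l → u ∈ l ∧ v ∈ l
  | [], h => by simp [halfEdges] at h
  | [_], h => by simp [halfEdges] at h
  | y :: x :: l, h => by
    have ih := @mem_of_mem_halfEdges u v (x :: l)
    by_cases hy : y ∈ x :: l
    · rw [halfEdges_old hy] at h
      have := ih (Finset.mem_of_mem_erase (Finset.mem_of_mem_erase h))
      exact ⟨List.mem_cons_of_mem _ this.1, List.mem_cons_of_mem _ this.2⟩
    · rw [halfEdges_new hy, Finset.mem_insert] at h
      rcases h with h | h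
      · rw [Prod.mk.injEq] at h
        simp [h.1, h.2]
      · exact ⟨List.mem_cons_of_mem _ (ih h).1, List.mem_cons_of_mem _ (ih h).2⟩

lemma halfEdges_asymm {u v : V} :
    ∀ {l : List V}, (u, v) ∈ halfEdges l → (v, u) ∉ halfEdges l
  | [], h => by simp [halfEdges] at h
  | [_], h => by simp [halfEdges] at h
  | y :: x :: l, h => by
    have ih := @halfEdges_asymm u v (x :: l)
    intro h'
    by_cases hy : y ∈ x :: l
    · rw [halfEdges_old hy] at h h'
      exact ih (Finset.mem_of_mem_erase (Finset.mem_of_mem_erase h))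
        (Finset.mem_of_mem_erase (Finset.mem_of_mem_erase h'))
    · rw [halfEdges_new hy, Finset.mem_insert, Prod.mk.injEq] at h h'
      rcases h with h | h <;> rcases h' with h' | h'
      · exact hy (by simp [← h.2, h'.1])
      · exact hy (h.2 ▸ (mem_of_mem_halfEdges h').1)
      · exact hy (h'.2 ▸ (mem_of_mem_halfEdges h).1)
      · exact ih h h'

/-- A vertex is discovered only once, so its parent is determined. This makes the upward default
return unique. -/
lemma halfEdges_parent_unique {u u' v : V} :
    ∀ {l : List V}, (u, v) ∈ halfEdges l → (u', v) ∈ halfEdges l → u = u'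
  | [], h, _ => by simp [halfEdges] at h
  | [_], h, _ => by simp [halfEdges] at h
  | y :: x :: l, h, h' => by
    have ih := @halfEdges_parent_unique u u' v (x :: l)
    by_cases hy : y ∈ x :: l
    · rw [halfEdges_old hy] at h h'
      exact ih (Finset.mem_of_mem_erase (Finset.mem_of_mem_erase h))
        (Finset.mem_of_mem_erase (Finset.mem_of_mem_erase h'))
    · rw [halfEdges_new hy, Finset.mem_insert, Prod.mk.injEq] at h h'
      rcases h with h | h <;> rcases h' with h' | h'
      · rw [h.1, h'.1]
      · exact absurd (h.2 ▸ (mem_of_mem_halfEdges h').2) hy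
      · exact absurd (h'.2 ▸ (mem_of_mem_halfEdges h).2) hy
      · exact ih h h'

lemma halfEdges_irrefl {u : V} {l : List V} : (u, u) ∉ halfEdges l :=
  fun h => halfEdges_asymm h h

lemma edgeCount_eq_zero_of_notMem {u v : V} :
    ∀ {l : List V}, v ∉ l → edgeCount l s(u, v) = 0
  | [], _ => rfl
  | [_], _ => rfl
  | y :: x :: l, h => by
    have ih := @edgeCount_eq_zero_of_notMem u v (x :: l)
    rw [edgeCount, ih (fun h' => h (List.mem_cons_of_mem _ h')), if_neg]
    intro he
    have : v ∈ s(x, y) := he ▸ Sym2.mem_mk_right u v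
    rw [Sym2.mem_iff] at this
    rcases this with rfl | rfl <;> simp at h

lemma edgeCount_of_mem_halfEdges {u v : V} :
    ∀ {l : List V}, (u, v) ∈ halfEdges l → edgeCount l s(u, v) = 1
  | [], h => by simp [halfEdges] at h
  | [_], h => by simp [halfEdges] at h
  | y :: x :: l, h => by
    have ih := @edgeCount_of_mem_halfEdges u v (x :: l)
    rw [edgeCount]
    by_cases hy : y ∈ x :: l
    · rw [halfEdges_old hy, Finset.mem_erase, Finset.mem_erase] at h
      rw [ih h.2.2, if_neg]
      intro he
      rw [Sym2.eq_iff] at he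
      rcases he with ⟨rfl, rfl⟩ | ⟨rfl, rfl⟩
      · exact h.2.1 rfl
      · exact h.1 rfl
    · rw [halfEdges_new hy, Finset.mem_insert, Prod.mk.injEq] at h
      rcases h with ⟨rfl, rfl⟩ | h
      · rw [edgeCount_eq_zero_of_notMem hy, if_pos rfl]
      · rw [ih h, if_neg]
        intro he
        have : y ∈ s(u, v) := he ▸ Sym2.mem_mk_right x y
        rw [Sym2.mem_iff] at this
        rcases this with rfl | rfl
        · exact hy (mem_of_mem_halfEdges h).1
        · exact hy (mem_of_mem_halfEdges h).2

lemma walkWeight_nonneg {a K : ℝ} (ha : 0 ≤ a) (hK : 0 ≤ K) :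
    ∀ l : List V, 0 ≤ walkWeight a K l
  | [] => zero_le_one
  | [_] => zero_le_one
  | y :: x :: l => by
    rw [walkWeight]
    refine mul_nonneg ?_ (walkWeight_nonneg ha hK _)
    split_ifs <;> linarith

/-! ### Edge moments against step weights -/

/-- Bound for the moment of order `m` of an edge variable. -/
def momentBound (a K : ℝ) : ℕ → ℝ
  | 0 => 1
  | 1 => K
  | m + 2 => a * K ^ m

/-- The contribution of the edge `e` to the weight of the walk `l`. -/
def edgeValue (a K : ℝ) (l : List V) (e : Sym2 V) : ℝ :=
  if e ∈ (halfEdges l).image (fun p => s(p.1, p.2)) then a else momentBound a K (edgeCount l e)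

lemma mem_image_halfEdges {l : List V} {x y : V} :
    s(x, y) ∈ (halfEdges l).image (fun p => s(p.1, p.2)) ↔
      (x, y) ∈ halfEdges l ∨ (y, x) ∈ halfEdges l := by
  simp only [Finset.mem_image, Prod.exists, Sym2.eq_iff]
  constructor
  · rintro ⟨u, v, h, ⟨rfl, rfl⟩ | ⟨rfl, rfl⟩⟩
    · exact Or.inl h
    · exact Or.inr h
  · rintro (h | h)
    · exact ⟨x, y, h, Or.inl ⟨rfl, rfl⟩⟩
    · exact ⟨y, x, h, Or.inr ⟨rfl, rfl⟩⟩

lemma momentBound_nonneg {a K : ℝ} (ha : 0 ≤ a) (hK : 0 ≤ K) (m : ℕ) :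
    0 ≤ momentBound a K m := by
  match m with
  | 0 => exact zero_le_one
  | 1 => exact hK
  | m + 2 => exact mul_nonneg ha (pow_nonneg hK _)

lemma momentBound_succ_le {a K : ℝ} (haK : a ≤ K ^ 2) (m : ℕ) :
    momentBound a K (m + 1) ≤ K * momentBound a K m := by
  match m with
  | 0 => simp [momentBound]
  -- Only the passage from the first to the second moment needs a ≤ K².
  | 1 => simpa [momentBound, ← sq] using haK
  | m + 2 => simp only [momentBound]; exact le_of_eq (by ring)

lemma edgeValue_nonneg {a K : ℝ} (ha : 0 ≤ a) (hK : 0 ≤ K) (l : List V) (e : Sym2 V) :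
    0 ≤ edgeValue a K l e := by
  rw [edgeValue]
  split_ifs
  exacts [ha, momentBound_nonneg ha hK _]

lemma edgeValue_cons_of_ne {a K : ℝ} {x y : V} {l : List V} {e : Sym2 V} (he : e ≠ s(x, y)) :
    edgeValue a K (y :: x :: l) e = edgeValue a K (x :: l) e := by
  induction e using Sym2.ind with
  | _ u v =>
  rw [edgeValue, edgeValue, edgeCount, if_neg he, add_zero]
  refine if_congr ?_ rfl rfl
  rw [mem_image_halfEdges, mem_image_halfEdges]
  rw [Ne, Sym2.eq_iff, not_or] at he
  by_cases hy : y ∈ x :: l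
  · rw [halfEdges_old hy]
    simp only [Finset.mem_erase, ne_eq, Prod.mk.injEq]
    tauto
  · rw [halfEdges_new hy]
    simp only [Finset.mem_insert, Prod.mk.injEq]
    tauto

variable [Fintype V]

/-- A discovery edge is charged its second moment a in advance, so its second traversal is free.
Each step changes the value of one edge only, by at most the weight of the step. -/
lemma prod_edgeValue_le {a K : ℝ} (ha : 0 ≤ a) (hK : 0 ≤ K) (haK : a ≤ K ^ 2) :
    ∀ l : List V, ∏ e, edgeValue a K l e ≤ walkWeight a K l
  | [] => by simp [edgeValue, halfEdges, edgeCount, momentBound, walkWeight]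
  | [_] => by simp [edgeValue, halfEdges, edgeCount, momentBound, walkWeight]
  | y :: x :: l => by
    have ih := prod_edgeValue_le ha hK haK (x :: l)
    rw [walkWeight]
    refine le_trans ?_ (mul_le_mul_of_nonneg_left ih (by split_ifs <;> linarith))
    rw [← Finset.mul_prod_erase Finset.univ (edgeValue a K (y :: x :: l)) (Finset.mem_univ s(x, y)),
      ← Finset.mul_prod_erase Finset.univ (edgeValue a K (x :: l)) (Finset.mem_univ s(x, y)),
      ← mul_assoc, Finset.prod_congr rfl (g := edgeValue a K (x :: l))
        fun e he => edgeValue_cons_of_ne (Finset.ne_of_mem_erase he)]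
    refine mul_le_mul_of_nonneg_right ?_ (Finset.prod_nonneg fun e _ => edgeValue_nonneg ha hK _ _)
    simp only [edgeValue, mem_image_halfEdges]
    by_cases hy : y ∈ x :: l
    · rw [halfEdges_old hy, edgeCount, if_pos rfl]
      simp only [Finset.mem_erase, ne_eq, Prod.mk.injEq, hy, not_true_eq_false, if_false,
        false_and, and_false, or_self]
      by_cases hR : (x, y) ∈ halfEdges (x :: l) ∨ (y, x) ∈ halfEdges (x :: l)
      · have hc : edgeCount (x :: l) s(x, y) = 1 := by
          rcases hR with h | h
          · exact edgeCount_of_mem_halfEdges h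
          · rw [Sym2.eq_swap]; exact edgeCount_of_mem_halfEdges h
        rw [if_pos hR, if_pos hR, hc]
        simp [momentBound]
      · rw [if_neg hR, if_neg hR]
        exact momentBound_succ_le haK _
    · have h1 : (x, y) ∉ halfEdges (x :: l) := fun h => hy (mem_of_mem_halfEdges h).2
      have h2 : (y, x) ∉ halfEdges (x :: l) := fun h => hy (mem_of_mem_halfEdges h).1
      rw [halfEdges_new hy, if_pos (Or.inl (Finset.mem_insert_self _ _)), if_pos hy,
        if_neg (not_or.2 ⟨h1, h2⟩), edgeCount_eq_zero_of_notMem hy]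
      simp [momentBound]

/-- Half-edges have been traversed exactly once. If no edge has multiplicity one, none is left and
the advance charges are all correct. -/
lemma prod_momentBound_le {a K : ℝ} (ha : 0 ≤ a) (hK : 0 ≤ K) (haK : a ≤ K ^ 2) (l : List V)
    (hl : ∀ e, edgeCount l e ≠ 1) :
    ∏ e, momentBound a K (edgeCount l e) ≤ walkWeight a K l := by
  refine le_trans (le_of_eq ?_) (prod_edgeValue_le ha hK haK l)
  refine Finset.prod_congr rfl fun e _ => ?_
  rw [edgeValue, if_neg]
  intro he
  obtain ⟨p, hp, rfl⟩ := Finset.mem_image.1 he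
  exact hl _ (edgeCount_of_mem_halfEdges hp)

/-! ### The potential and the sum over walks -/

/-- Number of edges in `A` starting from `u`. -/
def outDegree (A : Finset (V × V)) (u : V) : ℕ := (Finset.univ.filter fun v => (u, v) ∈ A).card

/-- The potential controlling the ambiguous return steps from `x`. -/
def excess (A : Finset (V × V)) (x : V) : ℕ :=
  ∑ u, if u = x then outDegree A u else outDegree A u - 1

lemma outDegree_insert {A : Finset (V × V)} {x y : V} (h : (x, y) ∉ A) (u : V) :
    outDegree (insert (x, y) A) u = outDegree A u + if u = x then 1 else 0 := by
  rw [outDegree, outDegree]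
  split_ifs with hu
  · subst hu
    rw [← Finset.card_insert_of_notMem (a := y) (by simpa using h)]
    congr 1
    ext v
    simp
  · simp [hu]

lemma outDegree_erase_of_ne {A : Finset (V × V)} {x y u : V} (h : u ≠ x) :
    outDegree (A.erase (x, y)) u = outDegree A u := by
  simp [outDegree, h]

lemma outDegree_erase_add_one {A : Finset (V × V)} {x y : V} (h : (x, y) ∈ A) :
    outDegree (A.erase (x, y)) x + 1 = outDegree A x := by
  have := outDegree_insert (A := A.erase (x, y)) (Finset.notMem_erase (x, y) A) x
  rw [Finset.insert_erase h, if_pos rfl] at this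
  exact this.symm

/-- The new out-edge at x is offset by the unit that x loses on ceasing to be the current vertex. -/
lemma excess_new {A : Finset (V × V)} {x y : V} (hxy : x ≠ y) (h : (x, y) ∉ A)
    (hy : outDegree A y = 0) : excess (insert (x, y) A) y = excess A x := by
  refine Finset.sum_congr rfl fun u _ => ?_
  rw [outDegree_insert h]
  by_cases h1 : u = x
  · subst h1; simp [hxy]
  · by_cases h2 : u = y
    · subst h2; simp [h1, hy]
    · simp [h1, h2]

lemma excess_move_le (A : Finset (V × V)) (x y : V) : excess A y ≤ excess A x + 1 := by
  have : (1 : ℕ) = ∑ u : V, if u = y then 1 else 0 := by simp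
  rw [this, excess, excess, ← Finset.sum_add_distrib]
  refine Finset.sum_le_sum fun u _ => ?_
  split_ifs <;> omega

lemma excess_child {A : Finset (V × V)} {x y : V} (hxy : x ≠ y) (h : (x, y) ∈ A) :
    excess (A.erase (x, y)) y + min 1 (outDegree A x - 1) ≤ excess A x := by
  have hd := outDegree_erase_add_one h
  have h1 (c : ℕ) (z : V) : c = ∑ u : V, if u = z then c else 0 := by simp
  -- The gain of at most 1 at y goes to the right-hand side, so that the sums compare vertex by
  -- vertex.
  suffices excess (A.erase (x, y)) y + min 2 (outDegree A x) ≤ excess A x + 1 by omega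
  rw [h1 (min 2 (outDegree A x)) x, h1 1 y, excess, excess, ← Finset.sum_add_distrib,
    ← Finset.sum_add_distrib]
  refine Finset.sum_le_sum fun u _ => ?_
  by_cases hu : u = x
  · subst hu; simp [hxy]; omega
  · rw [outDegree_erase_of_ne hu]; simp [hu]; split_ifs <;> omega

lemma excess_parent {A : Finset (V × V)} {x y : V} (hxy : x ≠ y) (h : (y, x) ∈ A) :
    excess (A.erase (y, x)) y + min 1 (outDegree A x) ≤ excess A x := by
  have hd := outDegree_erase_add_one h
  have h1 (c : ℕ) (z : V) : c = ∑ u : V, if u = z then c else 0 := by simp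
  rw [h1 (min 1 (outDegree A x)) x, excess, excess, ← Finset.sum_add_distrib]
  refine Finset.sum_le_sum fun u _ => ?_
  by_cases hu : u = y
  · subst hu; simp [hxy.symm]; omega
  · rw [outDegree_erase_of_ne hu, if_neg hu]; split_ifs with hx
    · subst hx; omega
    · omega

/-- The weight of a walk, enhanced by its potential. -/
noncomputable def walkPotential (a K L : ℝ) : List V → ℝ
  | x :: l => walkWeight a K (x :: l) * L ^ excess (halfEdges (x :: l)) x
  | [] => 1

lemma walkWeight_le_walkPotential {a K L : ℝ} (ha : 0 ≤ a) (hK : 0 ≤ K) (hL : 1 ≤ L)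
    (l : List V) : walkWeight a K l ≤ walkPotential a K L l := by
  match l with
  | [] => exact le_refl _
  | x :: l =>
    exact le_mul_of_one_le_right (walkWeight_nonneg ha hK _) (one_le_pow₀ hL)

/-- The unambiguous return steps. -/
def IsDefaultReturn (A : Finset (V × V)) (x y : V) : Prop :=
  ((x, y) ∈ A ∧ outDegree A x = 1) ∨ ((y, x) ∈ A ∧ outDegree A x = 0)

lemma isDefaultReturn_unique {l : List V} {x y z : V} (hy : IsDefaultReturn (halfEdges l) x y)
    (hz : IsDefaultReturn (halfEdges l) x z) : y = z := by
  rcases hy with ⟨hy, h1⟩ | ⟨hy, h1⟩ <;> rcases hz with ⟨hz, h2⟩ | ⟨hz, h2⟩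
  · rw [outDegree, Finset.card_eq_one] at h1
    obtain ⟨w, hw⟩ := h1
    have e1 : y ∈ ({w} : Finset V) := hw ▸ (by simpa using hy)
    have e2 : z ∈ ({w} : Finset V) := hw ▸ (by simpa using hz)
    rw [Finset.mem_singleton] at e1 e2
    rw [e1, e2]
  · omega
  · omega
  · exact halfEdges_parent_unique hy hz

open Classical in
lemma walkPotential_cons_le {a K L : ℝ} (ha : 0 ≤ a) (hK : 0 ≤ K) (hL : 1 ≤ L)
    (x y : V) (l : List V) :
    walkPotential a K L (y :: x :: l) ≤ walkPotential a K L (x :: l) *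
      (a + (if IsDefaultReturn (halfEdges (x :: l)) x y then 1 else 0) +
        if y ∈ x :: l then 1 / L + K * L else 0) := by
  have hL0 : 0 < L := lt_of_lt_of_le one_pos hL
  set A := halfEdges (x :: l) with hA
  rw [walkPotential, walkPotential, walkWeight, ← hA, mul_comm (ite _ _ _), mul_assoc, mul_assoc]
  refine mul_le_mul_of_nonneg_left ?_ (walkWeight_nonneg ha hK _)
  have hP : (0 : ℝ) < L ^ excess A x := pow_pos hL0 _
  have hd0 : (0 : ℝ) ≤ if IsDefaultReturn A x y then 1 else 0 := by split_ifs <;> norm_num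
  by_cases hy : y ∈ x :: l
  · rw [if_neg (not_not.2 hy), if_pos hy, halfEdges_old hy, ← hA]
    by_cases hR : (x, y) ∈ A ∨ (y, x) ∈ A
    · rw [if_pos hR, one_mul]
      have hxy : x ≠ y := by
        rintro rfl
        exact halfEdges_irrefl (hR.elim id id)
      set e' := excess ((A.erase (x, y)).erase (y, x)) y with he'
      -- A return is either default or lowers the potential, which gains a factor 1/L.
      have key : (IsDefaultReturn A x y ∧ e' ≤ excess A x) ∨ e' + 1 ≤ excess A x := by
        rcases hR with h | h
        · have h' : (y, x) ∉ A.erase (x, y) := fun h' =>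
            halfEdges_asymm h (Finset.mem_of_mem_erase h')
          rw [Finset.erase_eq_of_notMem h'] at he'
          have h3 := excess_child hxy h
          have h4 := outDegree_erase_add_one h
          by_cases h5 : outDegree A x = 1
          · exact Or.inl ⟨Or.inl ⟨h, h5⟩, by omega⟩
          · right; omega
        · have h' : (x, y) ∉ A := halfEdges_asymm h
          rw [Finset.erase_eq_of_notMem h'] at he'
          have h3 := excess_parent hxy h
          by_cases h5 : outDegree A x = 0
          · exact Or.inl ⟨Or.inr ⟨h, h5⟩, by omega⟩
          · right; omega
      rcases key with ⟨h1, h2⟩ | h2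
      · rw [if_pos h1]
        refine (pow_le_pow_right₀ hL h2).trans (le_mul_of_one_le_right hP.le ?_)
        have : 0 ≤ 1 / L + K * L := by positivity
        linarith
      · have h3 := pow_le_pow_right₀ hL h2
        rw [pow_succ, ← le_div_iff₀ hL0, ← mul_one_div] at h3
        refine h3.trans (mul_le_mul_of_nonneg_left ?_ hP.le)
        have : 0 ≤ K * L := by positivity
        linarith
    · rw [if_neg hR]
      rw [not_or] at hR
      rw [Finset.erase_eq_of_notMem hR.1, Finset.erase_eq_of_notMem hR.2]
      have h3 := pow_le_pow_right₀ hL (excess_move_le A x y)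
      rw [pow_succ] at h3
      refine (mul_le_mul_of_nonneg_left h3 hK).trans ?_
      have : 0 ≤ 1 / L := by positivity
      have : 0 ≤ L ^ excess A x *
        (a + (if IsDefaultReturn A x y then 1 else 0) + 1 / L) := by positivity
      linarith
  · rw [if_pos hy, if_neg hy, halfEdges_new hy, ← hA, excess_new]
    · have : 0 ≤ L ^ excess A x * (if IsDefaultReturn A x y then 1 else 0) := by positivity
      linarith
    · rintro rfl; simp at hy
    · exact fun h => hy (mem_of_mem_halfEdges h).2
    · rw [outDegree, Finset.card_eq_zero, Finset.filter_eq_empty_iff]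
      exact fun v _ h => hy (mem_of_mem_halfEdges h).1

/-- The 2 is one unit for discoveries and one for the default return; the rest can only end at one
of at most M visited vertices. -/
lemma sum_walkPotential_cons_le {a K L M : ℝ} (ha : 0 ≤ a) (hK : 0 ≤ K) (hL : 1 ≤ L)
    (haV : Fintype.card V * a ≤ 1) (x : V) (l : List V) (hM : ((x :: l).length : ℝ) ≤ M) :
    ∑ y, walkPotential a K L (y :: x :: l) ≤
      (2 + M * (1 / L + K * L)) * walkPotential a K L (x :: l) := by
  classical
  have hL0 : 0 < L := lt_of_lt_of_le one_pos hL
  have hP : 0 ≤ walkPotential a K L (x :: l) :=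
    (walkWeight_nonneg ha hK _).trans (walkWeight_le_walkPotential ha hK hL _)
  refine (Finset.sum_le_sum fun y _ => walkPotential_cons_le ha hK hL x y l).trans ?_
  rw [← Finset.mul_sum, mul_comm]
  refine mul_le_mul_of_nonneg_right ?_ hP
  rw [Finset.sum_add_distrib, Finset.sum_add_distrib]
  have h1 : ∑ _y : V, a ≤ 1 := by simpa using haV
  have h2 : ∑ y : V, (if IsDefaultReturn (halfEdges (x :: l)) x y then (1 : ℝ) else 0) ≤ 1 := by
    rw [Finset.sum_boole]
    norm_cast
    rw [Finset.card_le_one]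
    intro y hy z hz
    exact isDefaultReturn_unique (Finset.mem_filter.1 hy).2 (Finset.mem_filter.1 hz).2
  have h3 : ∑ y : V, (if y ∈ x :: l then 1 / L + K * L else 0) ≤ M * (1 / L + K * L) := by
    rw [← Finset.sum_filter, Finset.sum_const, nsmul_eq_mul]
    refine mul_le_mul_of_nonneg_right (le_trans ?_ hM) (by positivity)
    norm_cast
    refine le_trans (Finset.card_le_card (t := (x :: l).toFinset) ?_) (List.toFinset_card_le _)
    intro y hy
    simpa using hy
  linarith

/-- Sum of `F` over all extensions of a walk by `t` further steps. -/
def walkSum {R : Type*} [AddCommMonoid R] (F : List V → R) : ℕ → List V → R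
  | 0, l => F l
  | t + 1, l => ∑ y, walkSum F t (y :: l)

omit [DecidableEq V] in
lemma walkSum_mono {F G : List V → ℝ} (h : ∀ l, F l ≤ G l) (t : ℕ) (l : List V) :
    walkSum F t l ≤ walkSum G t l := by
  induction t generalizing l with
  | zero => exact h l
  | succ t ih => exact Finset.sum_le_sum fun y _ => ih _

lemma walkSum_walkPotential_le {a K L M : ℝ} (ha : 0 ≤ a) (hK : 0 ≤ K) (hL : 1 ≤ L)
    (hM0 : 0 ≤ M) (haV : Fintype.card V * a ≤ 1) (t : ℕ) (x : V) (l : List V)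
    (hM : ((x :: l).length : ℝ) + t ≤ M) :
    walkSum (walkPotential a K L) t (x :: l) ≤
      (2 + M * (1 / L + K * L)) ^ t * walkPotential a K L (x :: l) := by
  have hL0 : 0 < L := lt_of_lt_of_le one_pos hL
  induction t generalizing x l with
  | zero => simp [walkSum]
  | succ t ih =>
    rw [walkSum]
    refine (Finset.sum_le_sum fun y _ => ih y (x :: l) ?_).trans ?_
    · push_cast [List.length_cons] at hM ⊢
      linarith
    · rw [← Finset.mul_sum, pow_succ, mul_assoc]
      refine mul_le_mul_of_nonneg_left ?_ (by positivity)
      refine sum_walkPotential_cons_le ha hK hL haV x l ?_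
      push_cast at hM ⊢
      linarith [(Nat.cast_nonneg t : (0 : ℝ) ≤ t)]

lemma walkSum_walkWeight_le {a K L M : ℝ} (ha : 0 ≤ a) (hK : 0 ≤ K) (hL : 1 ≤ L)
    (haV : Fintype.card V * a ≤ 1) (t : ℕ) (x : V) (hM : 1 + (t : ℝ) ≤ M) :
    walkSum (walkWeight a K) t [x] ≤ (2 + M * (1 / L + K * L)) ^ t := by
  refine (walkSum_mono (walkWeight_le_walkPotential ha hK hL) t [x]).trans ?_
  refine (walkSum_walkPotential_le (M := M) ha hK hL ?_ haV t x [] (by simpa using hM)).trans ?_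
  · linarith [(Nat.cast_nonneg t : (0 : ℝ) ≤ t)]
  · simp [walkPotential, walkWeight, halfEdges, excess, outDegree]

end Walks

/-! ### Traces as sums over closed walks -/

section Trace

variable {V : Type*} [Fintype V] [DecidableEq V]

/-- Product of the matrix entries along a walk. -/
def walkProd {R : Type*} [CommSemiring R] (A : Matrix V V R) : List V → R
  | y :: x :: l => A x y * walkProd A (x :: l)
  | _ => 1

lemma walkSum_walkProd {R : Type*} [CommSemiring R] (A : Matrix V V R) (z : V) (t : ℕ) (x : V)
    (l : List V) :
    walkSum (fun l => if l.head? = some z then walkProd A l else 0) t (x :: l) =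
      walkProd A (x :: l) * (A ^ t) x z := by
  induction t generalizing x l with
  | zero => simp [walkSum, Matrix.one_apply]
  | succ t ih =>
    rw [walkSum, pow_succ', Matrix.mul_apply, Finset.mul_sum]
    refine Finset.sum_congr rfl fun y _ => ?_
    rw [ih, walkProd]
    ring

lemma trace_pow_eq_sum_walkSum {R : Type*} [CommSemiring R] (A : Matrix V V R) (t : ℕ) :
    (A ^ t).trace =
      ∑ x, walkSum (fun l => if l.head? = some x then walkProd A l else 0) t [x] := by
  refine Finset.sum_congr rfl fun x _ => ?_
  rw [walkSum_walkProd, walkProd, one_mul]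
  · rfl
  · simp

omit [DecidableEq V] in
lemma norm_walkSum_le {E : Type*} [SeminormedAddCommGroup E] (F : List V → E) (t : ℕ)
    (l : List V) : ‖walkSum F t l‖ ≤ walkSum (fun l => ‖F l‖) t l := by
  induction t generalizing l with
  | zero => exact le_refl _
  | succ t ih => exact (norm_sum_le _ _).trans (Finset.sum_le_sum fun y _ => ih _)

omit [DecidableEq V] in
lemma integrable_walkSum {Ω : Type*} [MeasurableSpace Ω] {μ : Measure Ω}
    {F : Ω → List V → ℂ} (hF : ∀ l, Integrable (fun ω => F ω l) μ) (t : ℕ) (l : List V) :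
    Integrable (fun ω => walkSum (F ω) t l) μ := by
  induction t generalizing l with
  | zero => exact hF l
  | succ t ih => exact integrable_finsetSum _ fun y _ => ih _

omit [DecidableEq V] in
lemma integral_walkSum {Ω : Type*} [MeasurableSpace Ω] {μ : Measure Ω}
    {F : Ω → List V → ℂ} (hF : ∀ l, Integrable (fun ω => F ω l) μ) (t : ℕ) (l : List V) :
    ∫ ω, walkSum (F ω) t l ∂μ = walkSum (fun l => ∫ ω, F ω l ∂μ) t l := by
  induction t generalizing l with
  | zero => rfl
  | succ t ih =>
    simp only [walkSum]
    rw [integral_finsetSum _ fun y _ => integrable_walkSum hF _ _]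
    exact Finset.sum_congr rfl fun y _ => ih _

/-- The matrix entry attached to an unordered pair. -/
def edgeEntry [LinearOrder V] {R : Type*} (A : Matrix V V R) (e : Sym2 V) : R := A e.inf e.sup

lemma prod_pow_add_ite {ι R : Type*} [Fintype ι] [DecidableEq ι] [CommMonoid R] (f : ι → R)
    (p : ι → ℕ) (i : ι) :
    ∏ e, f e ^ (p e + if e = i then 1 else 0) = f i * ∏ e, f e ^ p e := by
  simp only [pow_add, Finset.prod_mul_distrib, pow_ite, pow_one, pow_zero, Finset.prod_ite_eq',
    Finset.mem_univ, if_true]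
  rw [mul_comm]

end Trace

/-! ### Expectation of a walk product -/

section Trace

variable {V : Type*} [Fintype V] [LinearOrder V]

/-- The exponents depend on the walk alone, not on the matrix, so the factorization holds with the
same p and q for every outcome. -/
lemma exists_walkProd_eq :
    ∀ l : List V, ∃ p q : Sym2 V → ℕ, (∀ e, p e + q e = edgeCount l e) ∧
      ∀ A : Matrix V V ℂ, A.IsHermitian → walkProd A l =
        ∏ e, (edgeEntry A e ^ p e * (starRingEnd ℂ (edgeEntry A e)) ^ q e)
  | [] => ⟨0, 0, fun _ => rfl, fun A _ => by simp [walkProd]⟩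
  | [_] => ⟨0, 0, fun _ => rfl, fun A _ => by simp [walkProd]⟩
  | y :: x :: l => by
    obtain ⟨p, q, hpq, h⟩ := exists_walkProd_eq (x :: l)
    rcases le_total x y with hxy | hxy
    · refine ⟨fun e => p e + if e = s(x, y) then 1 else 0, q, fun e => ?_, fun A hA => ?_⟩
      · rw [edgeCount, ← hpq]; ring
      · rw [walkProd, h A hA, Finset.prod_mul_distrib, Finset.prod_mul_distrib, prod_pow_add_ite,
          mul_assoc]
        congr 1
        simp [edgeEntry, hxy]
    · refine ⟨p, fun e => q e + if e = s(x, y) then 1 else 0, fun e => ?_, fun A hA => ?_⟩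
      · rw [edgeCount, ← hpq]; ring
      · rw [walkProd, h A hA, Finset.prod_mul_distrib, Finset.prod_mul_distrib, prod_pow_add_ite,
          mul_left_comm]
        congr 1
        simp only [edgeEntry, Sym2.inf_mk, Sym2.sup_mk, hxy, inf_of_le_right, sup_of_le_left]
        rw [← hA.apply x y]
        rfl

variable {Ω : Type*} [MeasurableSpace Ω] {μ : Measure Ω} [IsProbabilityMeasure μ]

lemma norm_integral_pow_mul_conj_pow_le {a K : ℝ} {f : Ω → ℂ} (hf : Measurable f)
    (hK : 0 ≤ K) (hbd : ∀ ω, ‖f ω‖ ≤ K) (hvar : ∫ ω, ‖f ω‖ ^ 2 ∂μ ≤ a) (p q : ℕ) :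
    ‖∫ ω, f ω ^ p * (starRingEnd ℂ (f ω)) ^ q ∂μ‖ ≤ momentBound a K (p + q) := by
  refine (norm_integral_le_integral_norm _).trans ?_
  have hn : ∀ ω, ‖f ω ^ p * (starRingEnd ℂ (f ω)) ^ q‖ = ‖f ω‖ ^ (p + q) := fun ω => by
    rw [norm_mul, norm_pow, norm_pow, RCLike.norm_conj, pow_add]
  simp only [hn]
  have hint : ∀ m : ℕ, Integrable (fun ω => ‖f ω‖ ^ m) μ := fun m =>
    Integrable.of_bound (by fun_prop) (K ^ m) (Filter.Eventually.of_forall fun ω => by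
      rw [norm_pow, norm_norm]
      exact pow_le_pow_left₀ (norm_nonneg _) (hbd ω) m)
  rcases hm : p + q with _ | _ | m
  · simp [momentBound]
  · simp only [zero_add, pow_one, momentBound]
    refine (integral_mono (by simpa using hint 1) (integrable_const K) hbd).trans (by simp)
  · simp only [momentBound]
    calc ∫ ω, ‖f ω‖ ^ (m + 1 + 1) ∂μ ≤ ∫ ω, ‖f ω‖ ^ 2 * K ^ m ∂μ := by
          refine integral_mono (hint _) ((hint 2).mul_const _) fun ω => ?_
          simp only
          rw [add_assoc, pow_add, mul_comm]
          gcongr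
          exact hbd ω
      _ = (∫ ω, ‖f ω‖ ^ 2 ∂μ) * K ^ m := integral_mul_const _ _
      _ ≤ a * K ^ m := by gcongr

omit [Fintype V] [LinearOrder V] in
lemma measurable_walkProd {X : Ω → Matrix V V ℂ} (hX : ∀ i j, Measurable fun ω => X ω i j) :
    ∀ l : List V, Measurable fun ω => walkProd (X ω) l
  | [] => measurable_const
  | [_] => measurable_const
  | y :: x :: l => (hX x y).mul (measurable_walkProd hX (x :: l))

omit [Fintype V] [LinearOrder V] in
lemma norm_walkProd_le {A : Matrix V V ℂ} {K : ℝ} (hK : 0 ≤ K) (hA : ∀ i j, ‖A i j‖ ≤ K) :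
    ∀ l : List V, ‖walkProd A l‖ ≤ max K 1 ^ l.length
  | [] => by simp [walkProd]
  | [_] => by simp [walkProd]
  | y :: x :: l => by
    rw [walkProd, norm_mul, List.length_cons, pow_succ']
    exact mul_le_mul ((hA x y).trans (le_max_left _ _)) (norm_walkProd_le hK hA (x :: l))
      (norm_nonneg _) (by positivity)

omit [Fintype V] [LinearOrder V] in
lemma integrable_walkProd {X : Ω → Matrix V V ℂ} (hX : ∀ i j, Measurable fun ω => X ω i j)
    {K : ℝ} (hK : 0 ≤ K) (hbd : ∀ ω i j, ‖X ω i j‖ ≤ K) (l : List V) :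
    Integrable (fun ω => walkProd (X ω) l) μ :=
  Integrable.of_bound (measurable_walkProd hX l).aestronglyMeasurable _
    (Filter.Eventually.of_forall fun ω => norm_walkProd_le hK (hbd ω) l)

lemma norm_integral_walkProd_le {X : Ω → Matrix V V ℂ}
    (hX : ∀ i j, Measurable fun ω => X ω i j) (hherm : ∀ ω, (X ω).IsHermitian)
    (hindep : iIndepFun
      (fun (p : {p : V × V // p.1 ≤ p.2}) (ω : Ω) => X ω p.1.1 p.1.2) μ)
    (hcent : ∀ i j, ∫ ω, X ω i j ∂μ = 0) {a K : ℝ} (ha : 0 ≤ a) (hK : 0 ≤ K) (haK : a ≤ K ^ 2)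
    (hbd : ∀ ω i j, ‖X ω i j‖ ≤ K) (hvar : ∀ i j, ∫ ω, ‖X ω i j‖ ^ 2 ∂μ ≤ a) (l : List V) :
    ‖∫ ω, walkProd (X ω) l ∂μ‖ ≤ walkWeight a K l := by
  obtain ⟨p, q, hpq, h⟩ := exists_walkProd_eq l
  have hE : iIndepFun (fun (e : Sym2 V) ω => edgeEntry (X ω) e) μ :=
    hindep.precomp (g := Sym2.sortEquiv) Sym2.sortEquiv.injective
  have hmeas : ∀ e : Sym2 V, Measurable fun ω => edgeEntry (X ω) e := fun e => hX _ _
  have hfac : ∫ ω, walkProd (X ω) l ∂μ = ∏ e, ∫ ω,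
      edgeEntry (X ω) e ^ p e * (starRingEnd ℂ (edgeEntry (X ω) e)) ^ q e ∂μ := by
    simp only [fun ω => h (X ω) (hherm ω)]
    exact hE.integral_fun_prod_comp (f := fun e z => z ^ p e * (starRingEnd ℂ z) ^ q e)
      (fun e => (hmeas e).aemeasurable)
      fun e => (Continuous.aestronglyMeasurable (by fun_prop))
  rw [hfac, norm_prod]
  -- An edge used exactly once contributes a zero mean, or its conjugate.
  by_cases hl : ∀ e, edgeCount l e ≠ 1
  · refine le_trans (Finset.prod_le_prod (fun _ _ => norm_nonneg _) fun e _ => ?_)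
      (prod_momentBound_le ha hK haK l hl)
    rw [← hpq]
    exact norm_integral_pow_mul_conj_pow_le (hmeas e) hK (fun ω => hbd ω _ _) (hvar _ _) _ _
  · push Not at hl
    obtain ⟨e, he⟩ := hl
    rw [Finset.prod_eq_zero (Finset.mem_univ e)]
    · exact walkWeight_nonneg ha hK l
    · rw [← hpq] at he
      have hc : ∫ ω, edgeEntry (X ω) e ∂μ = 0 := hcent _ _
      rcases Nat.add_eq_one_iff.1 he with ⟨h1, h2⟩ | ⟨h1, h2⟩
      · simp only [h1, h2, pow_zero, pow_one, one_mul]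
        rw [integral_conj, hc]
        simp
      · simp [h1, h2, hc]

lemma norm_integral_trace_pow_le {X : Ω → Matrix V V ℂ}
    (hX : ∀ i j, Measurable fun ω => X ω i j) (hherm : ∀ ω, (X ω).IsHermitian)
    (hindep : iIndepFun
      (fun (p : {p : V × V // p.1 ≤ p.2}) (ω : Ω) => X ω p.1.1 p.1.2) μ)
    (hcent : ∀ i j, ∫ ω, X ω i j ∂μ = 0) {a K L M : ℝ} (ha : 0 ≤ a) (hK : 0 ≤ K)
    (haK : a ≤ K ^ 2) (hbd : ∀ ω i j, ‖X ω i j‖ ≤ K) (hvar : ∀ i j, ∫ ω, ‖X ω i j‖ ^ 2 ∂μ ≤ a)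
    (hL : 1 ≤ L) (haV : Fintype.card V * a ≤ 1) (t : ℕ) (hM : 1 + (t : ℝ) ≤ M) :
    Integrable (fun ω => (X ω ^ t).trace) μ ∧
      ‖∫ ω, (X ω ^ t).trace ∂μ‖ ≤ Fintype.card V * (2 + M * (1 / L + K * L)) ^ t := by
  have hF : ∀ (x : V) (l : List V),
      Integrable (fun ω => if l.head? = some x then walkProd (X ω) l else 0) μ := by
    intro x l
    split_ifs
    · exact integrable_walkProd hX hK hbd l
    · exact integrable_zero _ _ _
  simp only [trace_pow_eq_sum_walkSum]
  refine ⟨integrable_finsetSum _ fun x _ => integrable_walkSum (hF x) t [x], ?_⟩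
  rw [integral_finsetSum _ fun x _ => integrable_walkSum (hF x) t [x]]
  refine (norm_sum_le _ _).trans ?_
  rw [← nsmul_eq_mul]
  refine Finset.sum_le_card_nsmul _ _ _ fun x _ => ?_
  rw [integral_walkSum (hF x)]
  refine (norm_walkSum_le _ _ _).trans (le_trans (walkSum_mono (fun l => ?_) t [x])
    (walkSum_walkWeight_le ha hK hL haV t x hM))
  -- The constraint that the walk closes up is simply dropped from here on.
  split_ifs
  · exact norm_integral_walkProd_le hX hherm hindep hcent ha hK haK hbd hvar l
  · simpa using walkWeight_nonneg ha hK l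

end Trace

/-! ### Operator norm against trace -/

section Norm

variable {V : Type*} [Fintype V] [DecidableEq V]

lemma sq_norm_toEuclideanCLM_le (A : Matrix V V ℂ) :
    ‖Matrix.toEuclideanCLM (𝕜 := ℂ) A‖ ^ 2 ≤ ∑ i, ∑ j, ‖A i j‖ ^ 2 := by
  have h0 : 0 ≤ ∑ i, ∑ j, ‖A i j‖ ^ 2 := by positivity
  rw [← Real.le_sqrt (norm_nonneg _) h0]
  refine ContinuousLinearMap.opNorm_le_bound _ (Real.sqrt_nonneg _) fun x => ?_
  refine abs_le_of_sq_le_sq' ?_ (by positivity) |>.2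
  rw [mul_pow, Real.sq_sqrt h0, EuclideanSpace.norm_sq_eq, EuclideanSpace.norm_sq_eq,
    Finset.sum_mul]
  refine Finset.sum_le_sum fun i _ => ?_
  rw [Matrix.ofLp_toEuclideanCLM, Matrix.mulVec, dotProduct]
  refine le_trans ?_ (Finset.sum_mul_sq_le_sq_mul_sq Finset.univ (fun j => ‖A i j‖)
    fun j => ‖x j‖)
  refine pow_le_pow_left₀ (norm_nonneg _) ((norm_sum_le _ _).trans (le_of_eq ?_)) 2
  simp

/-- For self-adjoint A, ‖A‖^(2^j) = ‖A^(2^j)‖, and the squared Frobenius norm of A^(2^j) is the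
trace of its square. Hence exponents of the form 2·2^j. -/
lemma norm_pow_le_trace {A : Matrix V V ℂ} (hA : A.IsHermitian) (j : ℕ) :
    ‖Matrix.toEuclideanCLM (𝕜 := ℂ) A‖ ^ (2 * 2 ^ j) ≤ (A ^ (2 * 2 ^ j)).trace.re := by
  have hsa : IsSelfAdjoint (Matrix.toEuclideanCLM (𝕜 := ℂ) A) := by
    rw [IsSelfAdjoint, ← map_star]
    exact congrArg _ hA
  rw [mul_comm, pow_mul, ← hsa.norm_pow_two_pow, ← map_pow]
  refine (sq_norm_toEuclideanCLM_le _).trans (le_of_eq ?_)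
  rw [pow_mul, sq (A ^ 2 ^ j), Matrix.trace, Complex.re_sum]
  refine Finset.sum_congr rfl fun i _ => ?_
  rw [Matrix.diag_apply, Matrix.mul_apply, Complex.re_sum]
  refine Finset.sum_congr rfl fun k _ => ?_
  rw [← (hA.pow (2 ^ j)).apply k i, ← Complex.normSq_eq_norm_sq, Complex.star_def,
    Complex.mul_conj, Complex.ofReal_re]

end Norm

/-- Large deviation bound for the norm of a Hermitian matrix with bounded entries. -/
lemma measureReal_le_norm_le {V : Type*} [Fintype V] [LinearOrder V]
    {Ω : Type*} [MeasurableSpace Ω] {μ : Measure Ω} [IsProbabilityMeasure μ]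
    {X : Ω → Matrix V V ℂ}
    (hX : ∀ i j, Measurable fun ω => X ω i j) (hherm : ∀ ω, (X ω).IsHermitian)
    (hindep : iIndepFun
      (fun (p : {p : V × V // p.1 ≤ p.2}) (ω : Ω) => X ω p.1.1 p.1.2) μ)
    (hcent : ∀ i j, ∫ ω, X ω i j ∂μ = 0) {a K L M b : ℝ} (ha : 0 ≤ a) (hK : 0 ≤ K)
    (haK : a ≤ K ^ 2) (hbd : ∀ ω i j, ‖X ω i j‖ ≤ K) (hvar : ∀ i j, ∫ ω, ‖X ω i j‖ ^ 2 ∂μ ≤ a)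
    (hL : 1 ≤ L) (haV : Fintype.card V * a ≤ 1) (j : ℕ) (hM : 1 + 2 * 2 ^ j ≤ M) (hb : 0 < b) :
    μ.real {ω | b ≤ ‖Matrix.toEuclideanCLM (𝕜 := ℂ) (X ω)‖} ≤
      Fintype.card V * ((2 + M * (1 / L + K * L)) / b) ^ (2 * 2 ^ j) := by
  obtain ⟨hi, hle⟩ := norm_integral_trace_pow_le hX hherm hindep hcent ha hK haK hbd hvar hL haV
    (M := M) (2 * 2 ^ j) (by push_cast; exact hM)
  have hre : Integrable (fun ω => (X ω ^ (2 * 2 ^ j)).trace.re) μ := hi.re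
  have hmk := mul_meas_ge_le_integral_of_nonneg (Filter.Eventually.of_forall fun ω =>
    (pow_nonneg (norm_nonneg _) _).trans (norm_pow_le_trace (hherm ω) j)) hre (b ^ (2 * 2 ^ j))
  have hsub : μ.real {ω | b ≤ ‖Matrix.toEuclideanCLM (𝕜 := ℂ) (X ω)‖} ≤
      μ.real {ω | b ^ (2 * 2 ^ j) ≤ (X ω ^ (2 * 2 ^ j)).trace.re} :=
    measureReal_mono fun ω hω =>
      (pow_le_pow_left₀ hb.le hω _).trans (norm_pow_le_trace (hherm ω) j)
  have hint : ∫ ω, (X ω ^ (2 * 2 ^ j)).trace.re ∂μ ≤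
      Fintype.card V * (2 + M * (1 / L + K * L)) ^ (2 * 2 ^ j) := by
    refine le_trans (le_of_eq (integral_re hi)) ((Complex.re_le_norm _).trans hle)
  rw [div_pow, ← mul_div_assoc, le_div_iff₀ (pow_pos hb _), mul_comm]
  exact (mul_le_mul_of_nonneg_left hsub (by positivity)).trans (hmk.trans hint)

/-! ### Truncation and recentring -/

/-- Replace a complex number of modulus larger than `K` by zero. -/
noncomputable def truncate (K : ℝ) (z : ℂ) : ℂ := if ‖z‖ ≤ K then z else 0

lemma measurable_truncate (K : ℝ) : Measurable (truncate K) :=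
  Measurable.ite (measurableSet_le measurable_norm measurable_const) measurable_id
    measurable_const

lemma norm_truncate_le {K : ℝ} (hK : 0 ≤ K) (z : ℂ) : ‖truncate K z‖ ≤ K := by
  rw [truncate]
  split_ifs with h
  exacts [h, by simpa using hK]

lemma norm_truncate_le_norm (K : ℝ) (z : ℂ) : ‖truncate K z‖ ≤ ‖z‖ := by
  rw [truncate]
  split_ifs
  exacts [le_rfl, by simp]

lemma truncate_conj (K : ℝ) (z : ℂ) :
    truncate K (starRingEnd ℂ z) = starRingEnd ℂ (truncate K z) := by
  simp only [truncate, RCLike.norm_conj, apply_ite (starRingEnd ℂ), map_zero]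

section

variable {Ω : Type*} [MeasurableSpace Ω] {μ : Measure Ω} [IsProbabilityMeasure μ]

lemma integrable_truncate {f : Ω → ℂ} (hf : Measurable f) {K : ℝ} (hK : 0 ≤ K) :
    Integrable (fun ω => truncate K (f ω)) μ :=
  Integrable.of_bound ((measurable_truncate K).comp hf).aestronglyMeasurable K
    (Filter.Eventually.of_forall fun _ => norm_truncate_le hK _)

lemma integral_norm_sub_mean_sq_le {f : Ω → ℂ} (hf : MemLp f 2 μ) :
    ∫ ω, ‖f ω - ∫ ω, f ω ∂μ‖ ^ 2 ∂μ ≤ ∫ ω, ‖f ω‖ ^ 2 ∂μ := by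
  set m := ∫ ω, f ω ∂μ with hm
  have hi : Integrable f μ := hf.integrable one_le_two
  have hre : ∫ ω, (f ω).re ∂μ = m.re := integral_re hi
  have him : ∫ ω, (f ω).im ∂μ = m.im := integral_im hi
  have hire : Integrable (fun ω => (f ω).re) μ := hi.re
  have hiim : Integrable (fun ω => (f ω).im) μ := hi.im
  have hsq : ∀ z : ℂ, ‖z‖ ^ 2 = z.re * z.re + z.im * z.im := fun z => by
    rw [← Complex.normSq_eq_norm_sq, Complex.normSq_apply]
  have hexp : ∀ ω, ‖f ω - m‖ ^ 2 =
      ‖f ω‖ ^ 2 - (2 * m.re * (f ω).re + 2 * m.im * (f ω).im) + ‖m‖ ^ 2 := fun ω => by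
    rw [hsq, hsq, hsq, Complex.sub_re, Complex.sub_im]
    ring
  simp only [hexp]
  have hi2 : Integrable (fun ω => ‖f ω‖ ^ 2) μ := hf.integrable_norm_pow two_ne_zero
  have hlin : Integrable (fun ω => 2 * m.re * (f ω).re + 2 * m.im * (f ω).im) μ :=
    (hire.const_mul _).add (hiim.const_mul _)
  have hdiff : Integrable
      (fun ω => ‖f ω‖ ^ 2 - (2 * m.re * (f ω).re + 2 * m.im * (f ω).im)) μ := hi2.sub hlin
  rw [integral_add hdiff (integrable_const _), integral_sub hi2 hlin,
    integral_add (hire.const_mul _) (hiim.const_mul _), integral_const_mul, integral_const_mul,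
    hre, him, integral_const, hsq m]
  simp only [probReal_univ, one_smul]
  nlinarith [mul_self_nonneg m.re, mul_self_nonneg m.im]

/-- By centring, only the discarded part of f matters; there ‖f‖ ≤ s‖f‖² + 1/s. -/
lemma norm_integral_truncate_le {f : Ω → ℂ} (hf : Measurable f) (hL2 : MemLp f 2 μ)
    (hcent : ∫ ω, f ω ∂μ = 0) {K s : ℝ} (hK : 0 ≤ K) (hs : 0 < s) :
    ‖∫ ω, truncate K (f ω) ∂μ‖ ≤ s * ∫ ω, ‖f ω‖ ^ 2 ∂μ + μ.real {ω | K ≤ ‖f ω‖} / s := by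
  have hi : Integrable f μ := hL2.integrable one_le_two
  have hi2 : Integrable (fun ω => ‖f ω‖ ^ 2) μ := hL2.integrable_norm_pow two_ne_zero
  have hS : MeasurableSet {ω | K ≤ ‖f ω‖} := measurableSet_le measurable_const hf.norm
  have hind : Integrable ({ω | K ≤ ‖f ω‖}.indicator fun _ => 1 / s) μ :=
    (integrable_const _).indicator hS
  have h1 : ∫ ω, truncate K (f ω) ∂μ = ∫ ω, (truncate K (f ω) - f ω) ∂μ := by
    rw [integral_sub (integrable_truncate hf hK) hi, hcent, sub_zero]
  have h2 : s * ∫ ω, ‖f ω‖ ^ 2 ∂μ + μ.real {ω | K ≤ ‖f ω‖} / s =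
      ∫ ω, (s * ‖f ω‖ ^ 2 + {ω | K ≤ ‖f ω‖}.indicator (fun _ => 1 / s) ω) ∂μ := by
    rw [integral_add (hi2.const_mul s) hind, integral_const_mul, integral_indicator_const _ hS,
      smul_eq_mul, mul_one_div]
  rw [h1, h2]
  refine norm_integral_le_of_norm_le ((hi2.const_mul s).add hind)
    (Filter.Eventually.of_forall fun ω => ?_)
  rw [truncate]
  split_ifs with h
  · rw [sub_self, norm_zero]
    exact add_nonneg (by positivity) (Set.indicator_nonneg (fun _ _ => by positivity) _)
  · have hmem : ω ∈ {ω | K ≤ ‖f ω‖} := (not_le.1 h).le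
    rw [Set.indicator_of_mem hmem, zero_sub, norm_neg]
    have : s * ‖f ω‖ ^ 2 + 1 / s - ‖f ω‖ = s * ((‖f ω‖ - 1 / (2 * s)) ^ 2 + 3 / (4 * s ^ 2)) := by
      field_simp
      ring
    have : 0 ≤ s * ((‖f ω‖ - 1 / (2 * s)) ^ 2 + 3 / (4 * s ^ 2)) := by positivity
    linarith

end

lemma norm_toEuclideanCLM_le_of_entries {n : ℕ} {A : Matrix (Fin n) (Fin n) ℂ} {B : ℝ}
    (hB : 0 ≤ B) (hA : ∀ i j, ‖A i j‖ ≤ B) : ‖Matrix.toEuclideanCLM (𝕜 := ℂ) A‖ ≤ n * B := by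
  refine abs_le_of_sq_le_sq' ?_ (by positivity) |>.2
  refine (sq_norm_toEuclideanCLM_le A).trans ?_
  calc ∑ i, ∑ j, ‖A i j‖ ^ 2 ≤ ∑ _i : Fin n, ∑ _j : Fin n, B ^ 2 := by
        gcongr with i _ j _
        exact hA i j
    _ = (n * B) ^ 2 := by simp; ring

/-- Comparison of the norm of a random matrix with that of a matrix with bounded entries. -/
lemma measureReal_le_norm_le_add {n : ℕ} (hn : 1 ≤ n)
    {Ω : Type*} [MeasurableSpace Ω] {μ : Measure Ω} [IsProbabilityMeasure μ]
    {H : Ω → Matrix (Fin n) (Fin n) ℂ}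
    (hmeas : ∀ i j, Measurable (fun ω => H ω i j)) (hherm : ∀ ω, (H ω).IsHermitian)
    (hindep : iIndepFun
      (fun (p : {p : Fin n × Fin n // p.1 ≤ p.2}) (ω : Ω) => H ω p.1.1 p.1.2) μ)
    (hL2 : ∀ i j, MemLp (fun ω => H ω i j) 2 μ)
    (hcent : ∀ i j, ∫ ω, H ω i j ∂μ = 0)
    (hvar : ∀ i j, (n : ℝ) * ∫ ω, ‖H ω i j‖ ^ 2 ∂μ ≤ 1)
    {K P s ε M L : ℝ} (hK : 0 ≤ K) (hs : 0 < s) (hε : 0 < ε)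
    (htail : ∀ i j, μ.real {ω | K ≤ ‖H ω i j‖} ≤ P)
    (hKn : 1 ≤ n * (2 * K) ^ 2) (hsP : s + n * P / s ≤ ε / 2) (hL : 1 ≤ L) (j : ℕ)
    (hM : 1 + 2 * 2 ^ j ≤ M) :
    μ.real {ω | 2 + ε ≤ ‖Matrix.toEuclideanCLM (𝕜 := ℂ) (H ω)‖} ≤
      n * (n * P) + n * ((2 + M * (1 / L + 2 * K * L)) / (2 + ε / 2)) ^ (2 * 2 ^ j) := by
  have hn0 : (0 : ℝ) < n := by exact_mod_cast hn
  have hvar' : ∀ i j, ∫ ω, ‖H ω i j‖ ^ 2 ∂μ ≤ 1 / n := fun i j => by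
    rw [le_div_iff₀ hn0, mul_comm]
    exact hvar i j
  have hP : 0 ≤ P := measureReal_nonneg.trans (htail ⟨0, hn⟩ ⟨0, hn⟩)
  set m : Matrix (Fin n) (Fin n) ℂ := fun i j => ∫ ω, truncate K (H ω i j) ∂μ with hm
  set X : Ω → Matrix (Fin n) (Fin n) ℂ := fun ω i j => truncate K (H ω i j) - m i j with hX
  have hmn : ‖Matrix.toEuclideanCLM (𝕜 := ℂ) m‖ ≤ ε / 2 := by
    have hB : ∀ i j, ‖m i j‖ ≤ s / n + P / s := fun i j =>
      (norm_integral_truncate_le (hmeas i j) (hL2 i j) (hcent i j) hK hs).trans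
        (add_le_add ((mul_le_mul_of_nonneg_left (hvar' i j) hs.le).trans_eq (mul_one_div _ _))
          (div_le_div_of_nonneg_right (htail i j) hs.le))
    refine (norm_toEuclideanCLM_le_of_entries (by positivity) hB).trans (le_trans ?_ hsP)
    rw [mul_add, mul_div_cancel₀ _ hn0.ne', mul_div_assoc]
  have hTL2 : ∀ i j, MemLp (fun ω => truncate K (H ω i j)) 2 μ := fun i j =>
    MemLp.of_bound ((measurable_truncate K).comp (hmeas i j)).aestronglyMeasurable K
      (Filter.Eventually.of_forall fun _ => norm_truncate_le hK _)
  have hbound : μ.real {ω | 2 + ε / 2 ≤ ‖Matrix.toEuclideanCLM (𝕜 := ℂ) (X ω)‖} ≤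
      n * ((2 + M * (1 / L + 2 * K * L)) / (2 + ε / 2)) ^ (2 * 2 ^ j) := by
    -- Subtracting the mean can double the entry bound K.
    have := measureReal_le_norm_le (μ := μ) (X := X) (a := 1 / n) (K := 2 * K) (L := L) (M := M)
      (b := 2 + ε / 2) ?_ ?_ ?_ ?_ (by positivity) (by positivity) ?_ ?_ ?_ hL ?_ j hM
      (by positivity)
    · simpa using this
    · exact fun i j => ((measurable_truncate K).comp (hmeas i j)).sub_const _
    · intro ω
      ext i j
      rw [Matrix.conjTranspose_apply]
      simp only [hX, hm, star_sub]
      have hc : ∀ ω, truncate K (H ω i j) = starRingEnd ℂ (truncate K (H ω j i)) := fun ω => by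
        rw [← truncate_conj, ← (hherm ω).apply i j]
        rfl
      simp only [hc]
      rw [integral_conj]
      rfl
    · exact hindep.comp (fun p z => truncate K z - m p.1.1 p.1.2)
        fun p => (measurable_truncate K).sub_const _
    · intro i j
      simp only [hX]
      rw [integral_sub (integrable_truncate (hmeas i j) hK) (integrable_const _)]
      simp [hm]
    · rw [div_le_iff₀ hn0, mul_comm]
      exact hKn
    · intro ω i j
      refine (norm_sub_le _ _).trans ?_
      rw [two_mul]
      refine add_le_add (norm_truncate_le hK _) ?_
      refine (norm_integral_le_of_norm_le_const (C := K)
        (Filter.Eventually.of_forall fun ω => norm_truncate_le hK _)).trans ?_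
      simp
    · intro i j
      refine (integral_norm_sub_mean_sq_le (hTL2 i j)).trans (le_trans ?_ (hvar' i j))
      refine integral_mono ((hTL2 i j).integrable_norm_pow two_ne_zero)
        ((hL2 i j).integrable_norm_pow two_ne_zero) fun ω => ?_
      exact pow_le_pow_left₀ (norm_nonneg _) (norm_truncate_le_norm _ _) 2
    · simp [hn0.ne']
  have hsub : {ω | 2 + ε ≤ ‖Matrix.toEuclideanCLM (𝕜 := ℂ) (H ω)‖} ⊆
      (⋃ i, ⋃ j, {ω | K ≤ ‖H ω i j‖}) ∪
        {ω | 2 + ε / 2 ≤ ‖Matrix.toEuclideanCLM (𝕜 := ℂ) (X ω)‖} := by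
    intro ω hω
    by_cases hbig : ∃ i j, K ≤ ‖H ω i j‖
    · exact Or.inl (by simpa using hbig)
    · push Not at hbig
      right
      have hdec : H ω = X ω + m := by
        ext i j
        rw [Matrix.add_apply, sub_add_cancel, truncate, if_pos (hbig i j).le]
      simp only [Set.mem_ofPred_eq] at hω ⊢
      rw [hdec, map_add] at hω
      linarith [norm_add_le (Matrix.toEuclideanCLM (𝕜 := ℂ) (X ω))
        (Matrix.toEuclideanCLM (𝕜 := ℂ) m)]
  refine (measureReal_mono hsub).trans ((measureReal_union_le _ _).trans
    (add_le_add ?_ hbound))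
  calc μ.real (⋃ i, ⋃ j, {ω | K ≤ ‖H ω i j‖}) ≤ ∑ _i : Fin n, ∑ _j : Fin n, P :=
        (measureReal_iUnion_fintype_le _).trans (Finset.sum_le_sum fun i _ =>
          (measureReal_iUnion_fintype_le _).trans (Finset.sum_le_sum fun j _ => htail i j))
    _ = n * (n * P) := by simp

/-! ### Choice of parameters and conclusion -/

lemma exists_power_of_two_moment {ε η β : ℝ} (hε : 0 < ε) (hη : 0 < η) (hβ : 0 < β) :
    ∃ N : ℕ, ∀ n : ℕ, N ≤ n → ∃ (j : ℕ) (M L : ℝ), 1 ≤ L ∧ 1 + 2 * 2 ^ j ≤ M ∧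
      n * ((2 + M * (1 / L + 2 * (n : ℝ) ^ (-η) * L)) / (2 + ε / 2)) ^ (2 * 2 ^ j) ≤
        (n : ℝ) ^ (-β) := by
  set δ := min (ε / 8) 1 with hδ
  have hδ0 : 0 < δ := lt_min (by positivity) one_pos
  set r := (2 + ε / 4) / (2 + ε / 2) with hr
  have hr0 : 0 < r := by positivity
  have hr1 : r < 1 := by rw [hr, div_lt_one (by positivity)]; linarith
  have hlr : 0 < -Real.log r := neg_pos.2 (Real.log_neg hr0 hr1)
  -- Chosen so that r^(κ log n) = n^(-(1+β)), which also absorbs the factor n from the trace.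
  set κ := (1 + β) / -Real.log r with hκ
  have hκ0 : 0 < κ := by positivity
  -- The left side bounds M = 1 + 2·2^j, since 2^j ≤ 2κ log n + 3.
  have hlim : (fun x : ℝ => 4 * κ * Real.log x + 7) =o[Filter.atTop] fun x => x ^ (η / 2) :=
    ((isLittleO_log_rpow_atTop (half_pos hη)).const_mul_left _).add
      (Asymptotics.isLittleO_const_left.2 (Or.inr
        (tendsto_norm_atTop_atTop.comp (tendsto_rpow_atTop (half_pos hη)))))
  have hev := (hlim.bound (half_pos hδ0)).and (Filter.eventually_ge_atTop (1 : ℝ))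
  obtain ⟨N, hN⟩ := Filter.eventually_atTop.1 (tendsto_natCast_atTop_atTop.eventually hev)
  refine ⟨N, fun n hn => ?_⟩
  obtain ⟨h1, h2⟩ := hN n hn
  have hn0 : (0 : ℝ) < n := by linarith
  have hlog : 0 ≤ Real.log n := Real.log_nonneg h2
  set j := Nat.clog 2 ⌈κ * Real.log n⌉₊ with hj
  have hj1 : κ * Real.log n ≤ 2 ^ j := by
    refine (Nat.le_ceil _).trans ?_
    exact_mod_cast Nat.le_pow_clog one_lt_two _
  have hj2 : (2 : ℝ) ^ j ≤ 2 * (κ * Real.log n) + 3 := by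
    have hc : (⌈κ * Real.log n⌉₊ : ℝ) < κ * Real.log n + 1 := Nat.ceil_lt_add_one (by positivity)
    have hκl : 0 ≤ κ * Real.log n := by positivity
    rcases Nat.lt_or_ge 1 ⌈κ * Real.log n⌉₊ with h | h
    · have h3 := Nat.pow_pred_clog_lt_self one_lt_two h
      have h4 : 0 < j := Nat.clog_pos one_lt_two h
      rw [← hj] at h3
      have h5 : (2 : ℝ) ^ j = 2 * 2 ^ j.pred := by
        rw [← pow_succ', Nat.pred_eq_sub_one, Nat.sub_add_cancel h4]
      have h6 : (2 : ℝ) ^ j.pred < (⌈κ * Real.log n⌉₊ : ℝ) := by exact_mod_cast h3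
      rw [h5]
      linarith
    · have : j = 0 := by rw [hj, Nat.clog_of_right_le_one h]
      rw [this, pow_zero]
      linarith
  set M : ℝ := 1 + 2 * 2 ^ j with hM
  have hM1 : 1 ≤ M := by rw [hM]; linarith [pow_pos (two_pos : (0 : ℝ) < 2) j]
  have hM0 : 0 < M := by linarith
  have hMle : M ≤ δ / 2 * (n : ℝ) ^ (η / 2) := by
    rw [Real.norm_eq_abs, Real.norm_eq_abs, abs_of_nonneg (by positivity),
      abs_of_nonneg (by positivity)] at h1
    linarith
  have hMK : 2 * (n : ℝ) ^ (-η) * M ^ 2 ≤ δ ^ 2 := by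
    have h3 : M ^ 2 ≤ (δ / 2 * (n : ℝ) ^ (η / 2)) ^ 2 := pow_le_pow_left₀ hM0.le hMle 2
    have h4 : (n : ℝ) ^ (-η) * ((n : ℝ) ^ (η / 2)) ^ 2 = 1 := by
      rw [← Real.rpow_natCast, ← Real.rpow_mul hn0.le, ← Real.rpow_add hn0]
      norm_num
    calc 2 * (n : ℝ) ^ (-η) * M ^ 2
        ≤ 2 * (n : ℝ) ^ (-η) * (δ / 2 * (n : ℝ) ^ (η / 2)) ^ 2 := by gcongr
      _ = δ ^ 2 / 2 * ((n : ℝ) ^ (-η) * ((n : ℝ) ^ (η / 2)) ^ 2) := by ring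
      _ ≤ δ ^ 2 := by rw [h4]; nlinarith
  -- With L = M/δ, M/L equals δ and the other error term is at most δ; 2δ ≤ ε/4.
  refine ⟨j, M, M / δ, ?_, le_rfl, ?_⟩
  · rw [le_div_iff₀ hδ0, one_mul]
    exact (min_le_right _ _).trans hM1
  have hρ : 2 + M * (1 / (M / δ) + 2 * (n : ℝ) ^ (-η) * (M / δ)) ≤ 2 + ε / 4 := by
    have h3 : M * (1 / (M / δ) + 2 * (n : ℝ) ^ (-η) * (M / δ)) =
        δ + 2 * (n : ℝ) ^ (-η) * M ^ 2 / δ := by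
      field_simp
    have h4 : 2 * (n : ℝ) ^ (-η) * M ^ 2 / δ ≤ δ := by
      rw [div_le_iff₀ hδ0, ← sq]
      exact hMK
    rw [h3]
    linarith [min_le_left (ε / 8) 1]
  calc n * ((2 + M * (1 / (M / δ) + 2 * (n : ℝ) ^ (-η) * (M / δ))) / (2 + ε / 2)) ^ (2 * 2 ^ j)
      ≤ n * r ^ (2 * 2 ^ j) := by
        rw [hr]
        gcongr
    _ ≤ n * r ^ (2 ^ j) := by
        gcongr ?_ * ?_
        exact pow_le_pow_of_le_one hr0.le hr1.le (by omega)
    _ ≤ n * (n : ℝ) ^ (-(1 + β)) := by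
        gcongr ?_ * ?_
        rw [← Real.rpow_natCast, Real.rpow_def_of_pos hr0, Real.rpow_def_of_pos hn0]
        refine Real.exp_le_exp.2 ?_
        push_cast
        have h5 : κ * -Real.log r = 1 + β := div_mul_cancel₀ _ hlr.ne'
        have h6 := mul_le_mul_of_nonneg_right hj1 hlr.le
        have h7 : κ * Real.log n * -Real.log r = (1 + β) * Real.log n := by rw [← h5]; ring
        linarith
    _ = (n : ℝ) ^ (-β) := by
        nth_rewrite 1 [← Real.rpow_one (n : ℝ)]
        rw [← Real.rpow_add hn0]
        congr 1
        ring

theorem lemma6p1 (ε C₀ α : ℝ) (hε : 0 < ε) (hC₀ : 0 < C₀) (hα : 4 < α) :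
    ∃ C : ℝ, ∀ (n : ℕ) (_hn : 1 ≤ n)
      (Ω : Type*) [MeasurableSpace Ω] (μ : Measure Ω) [IsProbabilityMeasure μ]
      (H : Ω → Matrix (Fin n) (Fin n) ℂ)
      -- `H` is a random Hermitian matrix
      (_hmeas : ∀ i j, Measurable (fun ω => H ω i j))
      (_hherm : ∀ ω, (H ω).IsHermitian)
      -- the entries on and above the diagonal are independent
      (_hindep : iIndepFun
        (fun (p : {p : Fin n × Fin n // p.1 ≤ p.2}) (ω : Ω) => H ω p.1.1 p.1.2) μ)
      -- the entries are square integrable and centred, with `n E|H_ij|² ≤ 1`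
      (_hL2 : ∀ i j, MemLp (fun ω => H ω i j) 2 μ)
      (_hcent : ∀ i j, ∫ ω, H ω i j ∂μ = 0)
      (_hvar : ∀ i j, (n : ℝ) * ∫ ω, ‖H ω i j‖ ^ 2 ∂μ ≤ 1)
      -- tail bound
      (_htail : ∀ i j, ∀ t : ℝ, 0 < t →
        μ.real {ω | t ≤ √(n : ℝ) * ‖H ω i j‖} ≤ C₀ * t ^ (-α)),
      μ.real {ω | 2 + ε ≤ ‖Matrix.toEuclideanCLM (𝕜 := ℂ) (H ω)‖}
        ≤ C * (n : ℝ) ^ (-((α - 4) / 4)) := by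
  have hα0 : 0 < α := by linarith
  set β := (α - 4) / 4 with hβ
  have hβ0 : 0 < β := by rw [hβ]; linarith
  -- Since α/2 = 2β + 2 and ηα = β, the tail at n^(-η) is C₀ n^(-(β+2)); the union bound over n²
  -- entries then gives C₀ n^(-β).
  set η := β / α with hη
  have hη0 : 0 < η := by positivity
  have hη1 : η < 1 / 4 := by rw [hη, div_lt_iff₀ hα0, hβ]; linarith
  obtain ⟨N₁, hN₁⟩ := exists_power_of_two_moment hε hη0 hβ0
  obtain ⟨N₂, hN₂⟩ := exists_nat_ge (16 * C₀ / ε ^ 2)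
  set N := max N₁ N₂
  -- C₀ pays for the large entries, 1 for the moment bound, and N^β makes the claim trivial when n <
  -- N.
  refine ⟨C₀ + 1 + (N : ℝ) ^ β, ?_⟩
  intro n hn Ω _ μ _ H hmeas hherm hindep hL2 hcent hvar htail
  have hn1 : (1 : ℝ) ≤ n := by exact_mod_cast hn
  have hn0 : (0 : ℝ) < n := by linarith
  have hpow : 0 < (n : ℝ) ^ (-β) := Real.rpow_pos_of_pos hn0 _
  rcases lt_or_ge n N with hlt | hge
  · have h1 : 1 ≤ (N : ℝ) ^ β * (n : ℝ) ^ (-β) := by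
      rw [Real.rpow_neg hn0.le, ← div_eq_mul_inv, le_div_iff₀ (Real.rpow_pos_of_pos hn0 _),
        one_mul]
      exact Real.rpow_le_rpow hn0.le (by exact_mod_cast hlt.le) hβ0.le
    have h2 : 0 ≤ (C₀ + 1) * (n : ℝ) ^ (-β) := by positivity
    rw [add_mul]
    linarith [measureReal_le_one (μ := μ)
      (s := {ω | 2 + ε ≤ ‖Matrix.toEuclideanCLM (𝕜 := ℂ) (H ω)‖})]
  obtain ⟨j, M, L, hL, hM, hb⟩ := hN₁ n ((le_max_left _ _).trans hge)
  have hnN₂ : 16 * C₀ / ε ^ 2 ≤ n :=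
    hN₂.trans (by exact_mod_cast (le_max_right N₁ N₂).trans hge)
  set P := C₀ * (n : ℝ) ^ (-(β + 2)) with hP
  have hnP : n * (n * P) = C₀ * (n : ℝ) ^ (-β) := by
    have : (n : ℝ) ^ (-β) = n ^ 2 * (n : ℝ) ^ (-(β + 2)) := by
      rw [← Real.rpow_natCast, ← Real.rpow_add hn0]
      congr 1
      push_cast
      ring
    rw [this, hP]
    ring
  have hsP : ε / 4 + n * P / (ε / 4) ≤ ε / 2 := by
    have h1 : n * P ≤ C₀ / n := by
      rw [le_div_iff₀ hn0, mul_comm, hnP]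
      exact mul_le_of_le_one_right hC₀.le (Real.rpow_le_one_of_one_le_of_nonpos hn1 (by linarith))
    have h2 : C₀ / n ≤ ε ^ 2 / 16 := by
      rw [div_le_iff₀ (by positivity)] at hnN₂
      rw [div_le_iff₀ hn0]
      linarith
    have h3 : n * P / (ε / 4) ≤ ε / 4 := by
      rw [div_le_iff₀ (by positivity)]
      linarith
    linarith
  have hKn : 1 ≤ n * (2 * (n : ℝ) ^ (-η)) ^ 2 := by
    have h1 : n * (2 * (n : ℝ) ^ (-η)) ^ 2 = 4 * (n : ℝ) ^ (1 - 2 * η) := by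
      rw [mul_pow, ← Real.rpow_natCast ((n : ℝ) ^ (-η)), ← Real.rpow_mul hn0.le, sub_eq_add_neg,
        Real.rpow_add hn0, Real.rpow_one]
      push_cast
      ring_nf
    rw [h1]
    linarith [Real.one_le_rpow hn1 (by linarith : 0 ≤ 1 - 2 * η)]
  have hmain := measureReal_le_norm_le_add hn hmeas hherm hindep hL2 hcent hvar
    (K := (n : ℝ) ^ (-η)) (P := P) (s := ε / 4) (by positivity) (by positivity) hε ?_ hKn hsP hL
    j hM
  · refine hmain.trans ?_
    have h2 : 0 ≤ (N : ℝ) ^ β * (n : ℝ) ^ (-β) := by positivity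
    rw [hnP, add_mul, add_mul, one_mul]
    linarith
  · intro i k
    have hs : 0 < √(n : ℝ) := Real.sqrt_pos.2 hn0
    have h1 := htail i k (√(n : ℝ) * (n : ℝ) ^ (-η)) (by positivity)
    have h2 : {ω | √(n : ℝ) * (n : ℝ) ^ (-η) ≤ √(n : ℝ) * ‖H ω i k‖} =
        {ω | (n : ℝ) ^ (-η) ≤ ‖H ω i k‖} := by
      ext ω
      exact mul_le_mul_iff_right₀ hs
    rw [h2] at h1
    refine h1.trans (le_of_eq ?_)
    rw [hP, Real.sqrt_eq_rpow, ← Real.rpow_add hn0, ← Real.rpow_mul hn0.le]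
    congr 2
    have h3 : η * α = β := div_mul_cancel₀ _ hα0.ne'
    linear_combination h3 + 2 * hβ
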